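/- Let $n\ge 2$ be an integer, let $\beta>0$ be the positive solution of $\beta^n=1+\beta+\cdots+\beta^{n-1}$, and let $\lambda_1,\dots,\lambda_n\in\mathbb C$ be the roots of $x^n-(1+x+\cdots+x^{n-1})$, listed with multiplicity so that $|\lambda_1|\ge|\lambda_2|\ge\cdots\ge|\lambda_n|$. For $0\le x<1$ put $$f_\beta(x)=D(\beta)^{-1}\sum_{j=1}^n F_j(x),\qquad F_j=(\beta^j-\beta^{j-1}-\cdots-\beta)\,\chi_{[\beta^{-1}+\cdots+\beta^{-(j-1)},\;\beta^{-1}+\cdots+\beta^{-j})},$$ where $\chi_I$ is the indicator function of $I$ and $D(\beta)=\int_0^1\sum_{j=1}^nF_j(x)\,dx$, so that $\int_0^1 f_\beta(x)\,dx=1$. For $m\in\mathbb N$ let $\Omega_m$ be the set of words $J=(j_1,\dots,j_m)\in\{0,1\}^m$ in which no more than $n-1$ successive digits equal $1$. For $J\in\Omega_m$ let $r(J)$ be the number of successive $1$'s at the end of $J$, and put $L_{J,m}=\sum_{k=1}^m j_k\beta^{-k}$ and $K(J)=\beta^{-1}+\cdots+\beta^{-(n-r(J))}$. For a function $g$ on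 $[0,1)$ and $0\le x<1$ let $$g_m(x)=\beta^{-m}\sum_{J\in\Omega_m}\chi_{[0,K(J))}(x)\,g(L_{J,m}+\beta^{-m}x).$$ Then there are constants $C_1,C_2\ge 0$, depending only on $n$, such that for every probability density $g$ on $[0,1)$ and every $L_g$ with $|g(x)-g(y)|\le L_g|x-y|$ for all $x,y\in[0,1)$, and for all integers $m>2n$ and $m_1,m_2$ with $m_1+m_2=m$, $m_1\ge n-1$ and $m_2>2n-1$, $$\sup_{x\in[0,1)}|g_m(x)-f_\beta(x)|\le C_1\,\beta^{-m_1}L_g+C_2\,(\beta^{-1}|\lambda_2|)^{m_2}.$$ -/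

import Mathlib

open scoped ENNReal

namespace PseudoGolden

/-- The polynomial `X ^ n - (1 + X + ⋯ + X ^ (n - 1))` over `ℂ`. -/
noncomputable def charPoly (n : ℕ) : Polynomial ℂ :=
  Polynomial.X ^ n - ∑ i ∈ Finset.range n, Polynomial.X ^ i

/-- `lam 0, …, lam (n - 1)` lists all `n` roots of `charPoly n`, with multiplicity,
in the order of non-increasing absolute value. -/
structure IsRootOrdering (n : ℕ) (lam : Fin n → ℂ) : Prop where
  roots_eq : (charPoly n).roots = Finset.univ.val.map lam
  antitone_norm : Antitone fun j => ‖lam j‖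

/-- The partial sum `β⁻¹ + β⁻² + ⋯ + β⁻ʲ` (which is `0` for `j = 0`). -/
noncomputable def partialSum (β : ℝ) (j : ℕ) : ℝ :=
  ∑ i ∈ Finset.Icc 1 j, (β ^ i)⁻¹

/-- The binary words of length `m` with no `n` consecutive digits equal to `1`
(the digit `1` is `true`; the letter with index `k : Fin m` is the `(k + 1)`-st digit). -/
def admissible (n m : ℕ) : Set (Fin m → Bool) :=
  {J | ¬ ∃ i : ℕ, i + n ≤ m ∧ ∀ k : Fin m, i ≤ k → (k : ℕ) < i + n → J k = true}

open Classical in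
/-- `admissible n m` as a finite set. -/
noncomputable def Omega (n m : ℕ) : Finset (Fin m → Bool) :=
  Finset.univ.filter fun J => J ∈ admissible n m

/-- The left endpoint `∑ₖ jₖ β⁻ᵏ`, `k = 1, …, m`, of the cylinder interval of the word `J`. -/
noncomputable def leftEnd (β : ℝ) {m : ℕ} (J : Fin m → Bool) : ℝ :=
  ∑ k : Fin m, if J k = true then (β ^ ((k : ℕ) + 1))⁻¹ else 0

open Classical in
/-- The number of successive digits `1` at the end of the word `J`. -/
noncomputable def trailingOnes {m : ℕ} (J : Fin m → Bool) : ℕ :=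
  Nat.findGreatest (fun r => ∀ k : Fin m, m ≤ (k : ℕ) + r → J k = true) m

/-- The scaled length `K(J) = β⁻¹ + ⋯ + β^{-(n - r(J))}` of the cylinder interval of `J`. -/
noncomputable def scaledLength (n : ℕ) (β : ℝ) {m : ℕ} (J : Fin m → Bool) : ℝ :=
  partialSum β (n - trailingOnes J)

/-- `g_m(x) = β⁻ᵐ ∑_{J ∈ Ω_m} χ_{[0, K(J))}(x) g(L_J + β⁻ᵐ x)`. -/
noncomputable def pushDensity (n : ℕ) (β : ℝ) (g : ℝ → ℝ) (m : ℕ) (x : ℝ) : ℝ :=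
  (β ^ m)⁻¹ * ∑ J ∈ Omega n m,
    (Set.Ico 0 (scaledLength n β J)).indicator
      (fun y => g (leftEnd β J + (β ^ m)⁻¹ * y)) x

/-- The step function `F_j`, with value `β ^ j - (β ^ (j - 1) + ⋯ + β)` on
`[β⁻¹ + ⋯ + β^{-(j - 1)}, β⁻¹ + ⋯ + β^{-j})` and `0` elsewhere, for `j ≥ 1`. -/
noncomputable def stepFun (β : ℝ) (j : ℕ) : ℝ → ℝ :=
  (Set.Ico (partialSum β (j - 1)) (partialSum β j)).indicator
    fun _ => β ^ j - ∑ i ∈ Finset.Icc 1 (j - 1), β ^ i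

/-- The normalising constant `D(β)`, which makes the integral of `invDensity` equal to `1`. -/
noncomputable def normConst (n : ℕ) (β : ℝ) : ℝ :=
  ∫ x in Set.Ico (0 : ℝ) 1, ∑ j ∈ Finset.Icc 1 n, stepFun β j x

/-- The invariant density `f_β = D(β)⁻¹ (F_1 + ⋯ + F_n)`. -/
noncomputable def invDensity (n : ℕ) (β : ℝ) (x : ℝ) : ℝ :=
  (∑ j ∈ Finset.Icc 1 n, stepFun β j x) * (normConst n β)⁻¹

/-- `g` is a Lipschitz probability density on `[0, 1)` with Lipschitz constant `L`
(values of `g` outside `[0, 1)` are irrelevant; integrability follows from the Lipschitz bound). -/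
structure IsLipschitzDensity (g : ℝ → ℝ) (L : ℝ) : Prop where
  nonneg : ∀ x ∈ Set.Ico (0 : ℝ) 1, 0 ≤ g x
  integral_eq_one : ∫ x in Set.Ico (0 : ℝ) 1, g x = 1
  lipschitz : ∀ x ∈ Set.Ico (0 : ℝ) 1, ∀ y ∈ Set.Ico (0 : ℝ) 1, |g x - g y| ≤ L * |x - y|

/-- The distance `sup_{x ∈ [0, 1)} |h x - k x|` in `[0, ∞]`. -/
noncomputable def supDist (h k : ℝ → ℝ) : ℝ≥0∞ :=
  ⨆ x ∈ Set.Ico (0 : ℝ) 1, ENNReal.ofReal |h x - k x|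

end PseudoGolden

namespace PseudoGolden

/-! ### Words -/

/-! On [0, 1), `pushDensity n β g m` is P^m g, where P (`transfer`) is the transfer operator of x ↦
βx mod 1 (`pushDensity_eq_transfer_pow`). Write K_j for `partialSum β j`. Since β K_{j+1} = 1 + K_j
and K_n = 1, P preserves the span of the indicators of [0, K_j), j ≤ n (`transfer_indicator`). At a
fixed x, the powers of P on this span follow the n-step Fibonacci recurrence
(`transfer_pow_indicator`). Its characteristic roots are simple; the mode of β yields f_β(x) K_j,
and the other modes contribute O((|λ₂|/β)^m) (`exists_abs_transfer_pow_indicator_sub_le`).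

For Lipschitz g, write P^m = P^{m₂} P^{m₁}. Freezing g at the left ends of the cylinders of length
m₁ replaces P^{m₁} g by a nonnegative combination of those indicators, with pointwise error O(L
β^{-m₁}). P is positive and the functions P^k 1 are uniformly bounded, so P^{m₂} keeps the error of
that order. P preserves integrals, so the combination has mass 1 + O(L β^{-m₁}), and P^{m₂} sends it
to f_β times this mass, up to the spectral error. -/

theorem le_trailingOnes_iff {m : ℕ} (J : Fin m → Bool) (r : ℕ) :
    r ≤ trailingOnes J ↔ r ≤ m ∧ ∀ k : Fin m, m ≤ (k : ℕ) + r → J k = true := by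
  classical
  have h0 : ∀ k : Fin m, m ≤ (k : ℕ) + 0 → J k = true := fun k hk => by
    have := k.isLt
    omega
  constructor
  · intro h
    have hs := Nat.findGreatest_spec
      (P := fun r => ∀ k : Fin m, m ≤ (k : ℕ) + r → J k = true) (Nat.zero_le m) h0
    have hle : trailingOnes J ≤ m := Nat.findGreatest_le m
    refine ⟨h.trans hle, fun k hk => ?_⟩
    unfold trailingOnes at h
    refine hs k (hk.trans ?_)
    have : r ≤ _ := h
    convert Nat.add_le_add_left this (k : ℕ)
  · rintro ⟨h1, h2⟩
    exact Nat.le_findGreatest h1 h2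

theorem trailingOnes_snoc_true {m : ℕ} (J : Fin m → Bool) :
    trailingOnes (Fin.snoc J true : Fin (m + 1) → Bool) = trailingOnes J + 1 := by
  refine eq_of_forall_le_iff fun r => ?_
  cases r with
  | zero => simp
  | succ s =>
    rw [le_trailingOnes_iff, Nat.add_le_add_iff_right, Nat.add_le_add_iff_right,
      le_trailingOnes_iff, Fin.forall_fin_succ']
    simp [← add_assoc]

theorem trailingOnes_snoc_false {m : ℕ} (J : Fin m → Bool) :
    trailingOnes (Fin.snoc J false : Fin (m + 1) → Bool) = 0 := by
  refine Nat.eq_zero_of_not_pos fun h => ?_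
  have := ((le_trailingOnes_iff _ 1).1 h).2 (Fin.last m) (by simp)
  simp at this

theorem leftEnd_snoc (β : ℝ) {m : ℕ} (J : Fin m → Bool) (b : Bool) :
    leftEnd β (Fin.snoc J b : Fin (m + 1) → Bool) =
      leftEnd β J + if b = true then (β ^ (m + 1))⁻¹ else 0 := by
  simp [leftEnd, Fin.sum_univ_castSucc]

theorem trailingOnes_lt_of_mem {n m : ℕ} {J : Fin m → Bool}
    (hJ : J ∈ admissible n m) : trailingOnes J < n := by
  by_contra! h
  obtain ⟨h1, h2⟩ := (le_trailingOnes_iff J n).1 h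
  exact hJ ⟨m - n, by omega, fun k hk _ => h2 k (by omega)⟩

theorem snoc_false_mem_admissible {n m : ℕ} (hn : 0 < n) (J : Fin m → Bool) :
    (Fin.snoc J false : Fin (m + 1) → Bool) ∈ admissible n (m + 1) ↔ J ∈ admissible n m := by
  refine not_congr ⟨?_, ?_⟩
  · rintro ⟨i, h1, h2⟩
    have : i + n ≤ m := by
      by_contra! h
      have := h2 (Fin.last m) (by simp; omega) (by simp; omega)
      simp at this
    refine ⟨i, this, fun k hk hk' => ?_⟩
    simpa using h2 k.castSucc hk hk'
  · rintro ⟨i, h1, h2⟩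
    refine ⟨i, by omega, fun k => ?_⟩
    refine Fin.lastCases ?_ (fun k => ?_) k
    · intro _ h
      simp at h
      omega
    · simpa using h2 k

theorem snoc_true_mem_admissible {n m : ℕ} (J : Fin m → Bool) :
    (Fin.snoc J true : Fin (m + 1) → Bool) ∈ admissible n (m + 1) ↔
      J ∈ admissible n m ∧ trailingOnes J + 1 < n := by
  constructor
  · intro h
    refine ⟨?_, ?_⟩
    · rintro ⟨i, h1, h2⟩
      refine h ⟨i, by omega, fun k => ?_⟩
      refine Fin.lastCases (by simp) (fun k => ?_) k
      simpa using h2 k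
    · rw [← trailingOnes_snoc_true]
      exact trailingOnes_lt_of_mem h
  · rintro ⟨h1, h2⟩ ⟨i, h3, h4⟩
    by_cases hi : i + n ≤ m
    · exact h1 ⟨i, hi, fun k hk hk' => by simpa using h4 k.castSucc hk hk'⟩
    -- A run of n ones that does not fit into J must use the appended digit, so J itself ends in n -
    -- 1 ones.
    · have : n - 1 ≤ trailingOnes J := by
        rw [le_trailingOnes_iff]
        refine ⟨by omega, fun k hk => ?_⟩
        simpa using h4 k.castSucc (by simp; omega) (by simp; omega)
      omega

theorem mem_Omega {n m : ℕ} {J : Fin m → Bool} : J ∈ Omega n m ↔ J ∈ admissible n m := by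
  simp [Omega]

theorem sum_Omega_succ {n m : ℕ} (hn : 0 < n) (f : (Fin (m + 1) → Bool) → ℝ) :
    ∑ J ∈ Omega n (m + 1), f J = ∑ J ∈ Omega n m,
      (f (Fin.snoc J false) + if trailingOnes J + 1 < n then f (Fin.snoc J true) else 0) := by
  classical
  simp only [Omega, Finset.sum_filter]
  rw [← (Fin.snocEquiv fun _ : Fin (m + 1) => Bool).sum_comp, Fintype.sum_prod_type_right]
  refine Finset.sum_congr rfl fun J _ => ?_
  have hs : ∀ b, (Fin.snocEquiv fun _ : Fin (m + 1) => Bool) (b, J) = Fin.snoc J b :=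
    fun _ => rfl
  simp only [hs, Fintype.sum_bool, snoc_true_mem_admissible, snoc_false_mem_admissible hn]
  by_cases h : J ∈ admissible n m <;> simp [h, add_comm]

/-! ### Partial sums -/

theorem partialSum_zero (β : ℝ) : partialSum β 0 = 0 := by simp [partialSum]

theorem partialSum_succ (β : ℝ) (j : ℕ) :
    partialSum β (j + 1) = partialSum β j + (β ^ (j + 1))⁻¹ := by
  simp [partialSum, Finset.sum_Icc_succ_top]

theorem partialSum_strictMono {β : ℝ} (hβ : 0 < β) : StrictMono (partialSum β) :=
  strictMono_nat_of_lt_succ fun j => by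
    rw [partialSum_succ]
    have : 0 < (β ^ (j + 1))⁻¹ := by positivity
    linarith

theorem partialSum_nonneg {β : ℝ} (hβ : 0 < β) (j : ℕ) : 0 ≤ partialSum β j := by
  simpa [partialSum_zero] using (partialSum_strictMono hβ).monotone (Nat.zero_le j)

theorem mul_partialSum_succ {β : ℝ} (hβ : 0 < β) (j : ℕ) :
    β * partialSum β (j + 1) = 1 + partialSum β j := by
  induction j with
  | zero => simp [partialSum, hβ.ne']
  | succ j ih =>
    rw [partialSum_succ, mul_add, ih, partialSum_succ _ j, pow_succ β (j + 1)]
    field_simp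
    ring

theorem pow_mul_partialSum {β : ℝ} (hβ : 0 < β) (j : ℕ) :
    β ^ j * partialSum β j = ∑ i ∈ Finset.range j, β ^ i := by
  induction j with
  | zero => simp [partialSum_zero]
  | succ j ih =>
    rw [pow_succ, mul_assoc, mul_partialSum_succ hβ, mul_add, ih, Finset.sum_range_succ]
    ring

theorem partialSum_eq_one {n : ℕ} {β : ℝ} (hβ_pos : 0 < β)
    (hβ : β ^ n = ∑ i ∈ Finset.range n, β ^ i) : partialSum β n = 1 := by
  have h := pow_mul_partialSum hβ_pos n
  rw [← hβ] at h
  exact mul_left_cancel₀ (pow_pos hβ_pos n).ne' (by rw [h, mul_one])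

theorem inv_le_partialSum {β : ℝ} (hβ : 0 < β) {j : ℕ} (hj : 1 ≤ j) :
    β⁻¹ ≤ partialSum β j := by
  have := (partialSum_strictMono hβ).monotone hj
  simpa [partialSum] using this

theorem inv_mul_one_add_lt_iff {β : ℝ} (hβ_pos : 0 < β) {j : ℕ} (hj : 1 ≤ j) (x : ℝ) :
    β⁻¹ * (1 + x) < partialSum β j ↔ x < partialSum β (j - 1) := by
  obtain ⟨j, rfl⟩ : ∃ i, j = i + 1 := ⟨j - 1, by omega⟩
  rw [inv_mul_lt_iff₀ hβ_pos, mul_partialSum_succ hβ_pos]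
  simp

theorem inv_mul_lt_partialSum {β : ℝ} (hβ_pos : 0 < β) {j : ℕ} (hj : 1 ≤ j) {x : ℝ} (hx : x < 1) :
    β⁻¹ * x < partialSum β j := by
  have h := inv_le_partialSum hβ_pos hj
  have : β⁻¹ * x < β⁻¹ := mul_lt_of_lt_one_right (inv_pos.2 hβ_pos) hx
  linarith

/-! ### The transfer operator -/

open Classical in
/-- The transfer operator of the `β`-transformation on `[0, 1)`. -/
noncomputable def transfer (n : ℕ) (β : ℝ) : (ℝ → ℝ) →ₗ[ℝ] (ℝ → ℝ) where
  toFun g x := β⁻¹ * (g (β⁻¹ * x) +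
    if x < partialSum β (n - 1) then g (β⁻¹ * (1 + x)) else 0)
  map_add' g h := by
    ext x
    simp only [Pi.add_apply]
    split_ifs <;> ring
  map_smul' c g := by
    ext x
    simp only [Pi.smul_apply, smul_eq_mul, RingHom.id_apply]
    split_ifs <;> ring

theorem transfer_apply (n : ℕ) (β : ℝ) (g : ℝ → ℝ) (x : ℝ) :
    transfer n β g x = β⁻¹ * (g (β⁻¹ * x) +
      if x < partialSum β (n - 1) then g (β⁻¹ * (1 + x)) else 0) := by
  simp [transfer]

section
variable {n : ℕ} {β : ℝ} (hn : 2 ≤ n) (hβ_pos : 0 < β)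
  (hβ : β ^ n = ∑ i ∈ Finset.range n, β ^ i)
include hn hβ_pos hβ

theorem inv_le_one : β⁻¹ ≤ 1 := by
  rw [← partialSum_eq_one hβ_pos hβ]
  exact inv_le_partialSum hβ_pos (by omega)

theorem inv_mul_mem {x : ℝ} (hx : x ∈ Set.Ico (0 : ℝ) 1) : β⁻¹ * x ∈ Set.Ico (0 : ℝ) 1 :=
  ⟨mul_nonneg (inv_pos.2 hβ_pos).le hx.1,
    (mul_le_of_le_one_left hx.1 (inv_le_one hn hβ_pos hβ)).trans_lt hx.2⟩

theorem inv_mul_one_add_mem {x : ℝ} (hx : 0 ≤ x) (hx' : x < partialSum β (n - 1)) :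
    β⁻¹ * (1 + x) ∈ Set.Ico (0 : ℝ) 1 := by
  refine ⟨by positivity, ?_⟩
  have h := mul_partialSum_succ hβ_pos (n - 1)
  rw [Nat.sub_add_cancel (by omega), partialSum_eq_one hβ_pos hβ] at h
  rw [inv_mul_lt_iff₀ hβ_pos]
  linarith

theorem abs_transfer_le {r s : ℝ → ℝ} (h : ∀ x ∈ Set.Ico (0 : ℝ) 1, |r x| ≤ s x)
    {x : ℝ} (hx : x ∈ Set.Ico (0 : ℝ) 1) : |transfer n β r x| ≤ transfer n β s x := by
  rw [transfer_apply, transfer_apply, abs_mul, abs_of_pos (inv_pos.2 hβ_pos)]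
  refine mul_le_mul_of_nonneg_left ((abs_add_le _ _).trans ?_) (inv_pos.2 hβ_pos).le
  refine add_le_add (h _ (inv_mul_mem hn hβ_pos hβ hx)) ?_
  split_ifs with h1
  · exact h _ (inv_mul_one_add_mem hn hβ_pos hβ hx.1 h1)
  · simp

theorem abs_transfer_pow_le (m : ℕ) {r s : ℝ → ℝ} (h : ∀ x ∈ Set.Ico (0 : ℝ) 1, |r x| ≤ s x)
    {x : ℝ} (hx : x ∈ Set.Ico (0 : ℝ) 1) :
    |(transfer n β ^ m) r x| ≤ (transfer n β ^ m) s x := by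
  induction m generalizing x with
  | zero => simpa using h x hx
  | succ m ih =>
    rw [pow_succ']
    exact abs_transfer_le hn hβ_pos hβ (fun y hy => ih hy) hx

/-- Both inverse branches map into [0, 1), so values elsewhere never enter; functions on ℝ can thus
stand for functions on [0, 1). -/
theorem transfer_pow_congr (m : ℕ) {r s : ℝ → ℝ} (h : ∀ x ∈ Set.Ico (0 : ℝ) 1, r x = s x)
    {x : ℝ} (hx : x ∈ Set.Ico (0 : ℝ) 1) :
    (transfer n β ^ m) r x = (transfer n β ^ m) s x := by
  have := abs_transfer_pow_le hn hβ_pos hβ m (r := r - s) (s := 0)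
    (fun y hy => by simp [h y hy]) hx
  rw [map_sub, map_zero, Pi.sub_apply] at this
  exact sub_eq_zero.1 (abs_eq_zero.1 (le_antisymm this (abs_nonneg _)))

theorem pushDensity_zero (g : ℝ → ℝ) {x : ℝ} (hx : x ∈ Set.Ico (0 : ℝ) 1) :
    pushDensity n β g 0 x = g x := by
  have h1 : Omega n 0 = Finset.univ := by
    ext J
    simp only [mem_Omega, Finset.mem_univ, iff_true]
    rintro ⟨i, hi, -⟩
    omega
  have h2 : ∀ J : Fin 0 → Bool, trailingOnes J = 0 := fun J => by
    have := ((le_trailingOnes_iff J _).1 le_rfl).1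
    omega
  simp [pushDensity, h1, scaledLength, h2, partialSum_eq_one hβ_pos hβ, leftEnd,
    Set.indicator_of_mem hx]

/-- Appending a digit b to J amounts to evaluating the sum for J at the preimage (b + x)/β. The
digit 0 resets the scaled length to 1; the digit 1 lowers its index by one. -/
theorem pushDensity_succ (g : ℝ → ℝ) (m : ℕ) {x : ℝ} (hx : x ∈ Set.Ico (0 : ℝ) 1) :
    pushDensity n β g (m + 1) x = transfer n β (pushDensity n β g m) x := by
  rw [transfer_apply, pushDensity, sum_Omega_succ (by omega), pushDensity, pushDensity,
    pow_succ, mul_inv, mul_comm (β ^ m)⁻¹, mul_assoc]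
  congr 1
  rw [Finset.sum_add_distrib, mul_add]
  congr 1
  · congr 1
    refine Finset.sum_congr rfl fun J hJ => ?_
    have hr := trailingOnes_lt_of_mem (mem_Omega.1 hJ)
    rw [Set.indicator_of_mem, Set.indicator_of_mem, leftEnd_snoc]
    · simp only [Bool.false_eq_true, if_false, add_zero]
      congr 2
      ring
    · exact ⟨(inv_mul_mem hn hβ_pos hβ hx).1,
        inv_mul_lt_partialSum hβ_pos (by omega) hx.2⟩
    · rw [scaledLength, trailingOnes_snoc_false, Nat.sub_zero, partialSum_eq_one hβ_pos hβ]
      exact hx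
  · split_ifs with hc
    · congr 1
      refine Finset.sum_congr rfl fun J hJ => ?_
      have hr := trailingOnes_lt_of_mem (mem_Omega.1 hJ)
      have hK := inv_mul_one_add_lt_iff hβ_pos (j := n - trailingOnes J) (by omega) x
      have hx1 : 0 ≤ β⁻¹ * (1 + x) := (inv_mul_one_add_mem hn hβ_pos hβ hx.1 hc).1
      have hx0 : 0 ≤ x := hx.1
      simp only [Set.indicator, Set.mem_Ico, hx1, hx0, true_and, scaledLength,
        trailingOnes_snoc_true, hK, leftEnd_snoc, if_true]
      rw [← Nat.sub_sub]
      by_cases ht : trailingOnes J + 1 < n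
      · simp only [ht, if_true, pow_succ, mul_inv]
        congr 2
        ring
      -- J already ends in n - 1 ones: the digit 1 is forbidden, and the matching interval [0, K_0)
      -- is empty.
      · rw [if_neg ht, if_neg]
        rw [show n - trailingOnes J - 1 = 0 by omega, partialSum_zero]
        exact hx0.not_gt
    · refine mul_eq_zero_of_right _ (Finset.sum_eq_zero fun J _ => ?_)
      split_ifs with ht
      · refine Set.indicator_of_notMem (fun h => hc (h.2.trans_le ?_)) _
        rw [scaledLength, trailingOnes_snoc_true]
        exact (partialSum_strictMono hβ_pos).monotone (by omega)
      · rfl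

theorem pushDensity_eq_transfer_pow (g : ℝ → ℝ) (m : ℕ) {x : ℝ}
    (hx : x ∈ Set.Ico (0 : ℝ) 1) : pushDensity n β g m x = (transfer n β ^ m) g x := by
  induction m generalizing x with
  | zero => simpa using pushDensity_zero hn hβ_pos hβ g hx
  | succ m ih =>
    rw [pushDensity_succ hn hβ_pos hβ g m hx, pow_succ']
    simpa using transfer_pow_congr hn hβ_pos hβ 1 (fun y hy => ih hy) hx

/-- Needed because positivity and the Lipschitz bound for g are available only on [0, 1). The last
digit is absorbed into x by an inverse branch. -/
theorem leftEnd_add_mem {m : ℕ} {J : Fin m → Bool} (hJ : J ∈ admissible n m) {x : ℝ}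
    (hx : x ∈ Set.Ico 0 (scaledLength n β J)) :
    leftEnd β J + (β ^ m)⁻¹ * x ∈ Set.Ico (0 : ℝ) 1 := by
  induction m generalizing x with
  | zero =>
    have ht : trailingOnes J = 0 := by
      have := ((le_trailingOnes_iff J _).1 le_rfl).1
      omega
    simpa [leftEnd, scaledLength, ht, partialSum_eq_one hβ_pos hβ] using hx
  | succ m ih =>
    obtain ⟨J, b, rfl⟩ : ∃ J' b, J = Fin.snoc J' b := ⟨_, _, (Fin.snoc_init_self J).symm⟩
    cases b
    · rw [snoc_false_mem_admissible (by omega)] at hJ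
      rw [scaledLength, trailingOnes_snoc_false, Nat.sub_zero, partialSum_eq_one hβ_pos hβ] at hx
      have hr := trailingOnes_lt_of_mem hJ
      have := ih hJ (x := β⁻¹ * x) ⟨(inv_mul_mem hn hβ_pos hβ hx).1,
        inv_mul_lt_partialSum hβ_pos (by omega) hx.2⟩
      rw [leftEnd_snoc, pow_succ, mul_inv, mul_assoc]
      simpa using this
    · rw [snoc_true_mem_admissible] at hJ
      rw [scaledLength, trailingOnes_snoc_true, ← Nat.sub_sub] at hx
      have h0 : 0 ≤ β⁻¹ * (1 + x) := mul_nonneg (inv_pos.2 hβ_pos).le (by linarith [hx.1])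
      have := ih hJ.1 (x := β⁻¹ * (1 + x)) ⟨h0,
        (inv_mul_one_add_lt_iff hβ_pos (by omega) x).2 hx.2⟩
      rw [leftEnd_snoc, pow_succ, mul_inv]
      convert this using 1
      simp only [if_true]
      ring

theorem transfer_indicator {j : ℕ} (hj : j < n) {x : ℝ} (hx : x ∈ Set.Ico (0 : ℝ) 1) :
    transfer n β ((Set.Ico 0 (partialSum β (j + 1))).indicator 1) x =
      β⁻¹ * ((Set.Ico 0 (partialSum β n)).indicator 1 x +
        (Set.Ico 0 (partialSum β j)).indicator 1 x) := by
  have hx1 : 0 ≤ β⁻¹ * (1 + x) := mul_nonneg (inv_pos.2 hβ_pos).le (by linarith [hx.1])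
  have hm := (partialSum_strictMono hβ_pos).monotone (show j ≤ n - 1 by omega)
  have hmem : β⁻¹ * x ∈ Set.Ico 0 (partialSum β (j + 1)) :=
    ⟨(inv_mul_mem hn hβ_pos hβ hx).1, inv_mul_lt_partialSum hβ_pos (by omega) hx.2⟩
  rw [transfer_apply, partialSum_eq_one hβ_pos hβ, Set.indicator_of_mem hx,
    Set.indicator_of_mem hmem]
  congr 2
  have hx0 : 0 ≤ x := hx.1
  simp only [Set.indicator, Set.mem_Ico, hx1, hx0, true_and,
    inv_mul_one_add_lt_iff hβ_pos (Nat.le_add_left 1 j), Nat.add_sub_cancel]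
  by_cases h : x < partialSum β j
  · simp [h, h.trans_le hm]
  · simp [h]

/-- The two inverse branches are affine bijections onto [0, β⁻¹] and [β⁻¹, 1], up to endpoints, so
changing variables in each term recovers the whole integral. -/
theorem intervalIntegrable_and_integral_transfer {g : ℝ → ℝ}
    (hg : IntervalIntegrable g MeasureTheory.volume 0 1) :
    IntervalIntegrable (transfer n β g) MeasureTheory.volume 0 1 ∧
      ∫ x in (0 : ℝ)..1, transfer n β g x = ∫ x in (0 : ℝ)..1, g x := by
  have hb0 : 0 < β⁻¹ := inv_pos.2 hβ_pos
  have hb1 := inv_le_one hn hβ_pos hβ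
  set K := partialSum β (n - 1) with hK
  have hK0 : 0 ≤ K := partialSum_nonneg hβ_pos _
  have hK1 : K ≤ 1 := by
    rw [← partialSum_eq_one hβ_pos hβ]
    exact (partialSum_strictMono hβ_pos).monotone (Nat.sub_le n 1)
  have hβK : β⁻¹ * K + β⁻¹ = 1 := by
    have h := mul_partialSum_succ hβ_pos (n - 1)
    rw [Nat.sub_add_cancel (by omega), partialSum_eq_one hβ_pos hβ, ← hK] at h
    field_simp
    linarith
  have hg1 : IntervalIntegrable g MeasureTheory.volume 0 β⁻¹ := hg.mono_set (by
    rw [Set.uIcc_of_le hb0.le, Set.uIcc_of_le zero_le_one]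
    exact Set.Icc_subset_Icc le_rfl hb1)
  have hg2 : IntervalIntegrable g MeasureTheory.volume β⁻¹ 1 := hg.mono_set (by
    rw [Set.uIcc_of_le hb1, Set.uIcc_of_le zero_le_one]
    exact Set.Icc_subset_Icc hb0.le le_rfl)
  set A : ℝ → ℝ := fun x => β⁻¹ * g (β⁻¹ * x)
  set B : ℝ → ℝ := fun x => β⁻¹ * g (β⁻¹ * x + β⁻¹)
  set B' : ℝ → ℝ := fun x => if x < K then B x else 0
  have hA : IntervalIntegrable A MeasureTheory.volume 0 1 := by
    have := (hg1.comp_mul_left (c := β⁻¹)).const_mul β⁻¹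
    simpa [hb0.ne', hβ_pos.ne'] using this
  have hB : IntervalIntegrable B MeasureTheory.volume 0 K := by
    have := ((hg2.comp_add_right β⁻¹).comp_mul_left (c := β⁻¹)).const_mul β⁻¹
    have h2 : (1 - β⁻¹) / β⁻¹ = K := by
      rw [div_eq_iff hb0.ne']
      linarith
    rwa [h2, sub_self, zero_div] at this
  have hBK : Set.EqOn B B' (Set.uIoo 0 K) := fun x hx => by
    rw [Set.uIoo_of_le hK0] at hx
    simp [B', hx.2]
  have hB1 : Set.EqOn (0 : ℝ → ℝ) B' (Set.uIoo K 1) := fun x hx => by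
    rw [Set.uIoo_of_le hK1] at hx
    simp [B', hx.1.not_gt]
  have hB'K := hB.congr_uIoo hBK
  have hB'1 : IntervalIntegrable B' MeasureTheory.volume K 1 :=
    (IntervalIntegrable.zero).congr_uIoo hB1
  have hsum : transfer n β g = A + B' := by
    ext x
    simp only [transfer_apply, Pi.add_apply, A, B', B, mul_add, ← hK, mul_ite, mul_zero, mul_one,
      add_comm (β⁻¹ * x)]
  refine ⟨hsum ▸ hA.add (hB'K.trans hB'1), ?_⟩
  have e1 : ∫ x in (0 : ℝ)..1, A x = ∫ x in (0 : ℝ)..β⁻¹, g x := by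
    simp only [A]
    rw [intervalIntegral.integral_const_mul, intervalIntegral.mul_integral_comp_mul_left]
    simp
  have e2 : ∫ x in (0 : ℝ)..1, B' x = ∫ x in β⁻¹..1, g x := by
    rw [← intervalIntegral.integral_add_adjacent_intervals hB'K hB'1,
      ← intervalIntegral.integral_congr_uIoo hBK, ← intervalIntegral.integral_congr_uIoo hB1]
    simp only [B]
    rw [intervalIntegral.integral_const_mul, intervalIntegral.mul_integral_comp_mul_add, hβK]
    simp
  rw [hsum]
  simp only [Pi.add_apply]
  rw [intervalIntegral.integral_add hA (hB'K.trans hB'1), e1, e2,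
    intervalIntegral.integral_add_adjacent_intervals hg1 hg2]

theorem intervalIntegrable_and_integral_transfer_pow {g : ℝ → ℝ}
    (hg : IntervalIntegrable g MeasureTheory.volume 0 1) (m : ℕ) :
    IntervalIntegrable ((transfer n β ^ m) g) MeasureTheory.volume 0 1 ∧
      ∫ x in (0 : ℝ)..1, (transfer n β ^ m) g x = ∫ x in (0 : ℝ)..1, g x := by
  induction m with
  | zero => simpa using hg
  | succ m ih =>
    have := intervalIntegrable_and_integral_transfer hn hβ_pos hβ ih.1
    rw [pow_succ']
    exact ⟨this.1, this.2.trans ih.2⟩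
end

/-! ### The `n`-step Fibonacci recurrence -/

theorem sum_indicator_partialSum {β : ℝ} (hβ : 0 < β) (j : ℕ) (x : ℝ) :
    ∑ i ∈ Finset.range j, (Set.Ico (partialSum β i) (partialSum β (i + 1))).indicator 1 x =
      (Set.Ico 0 (partialSum β j)).indicator (1 : ℝ → ℝ) x := by
  induction j with
  | zero => simp [partialSum_zero]
  | succ j ih =>
    rw [Finset.sum_range_succ, ih]
    have h1 := partialSum_nonneg hβ j
    have h2 := partialSum_strictMono hβ (Nat.lt_succ_self j)
    simp only [Set.indicator, Set.mem_Ico, Pi.one_apply]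
    grind

theorem exists_recurrence (n : ℕ) (v : ℕ → ℝ) : ∃ y : ℕ → ℝ, (∀ k < n, y k = v k) ∧
    ∀ k, y (k + n) = ∑ i ∈ Finset.range n, y (k + i) := by
  let E : LinearRecurrence ℝ := ⟨n, fun _ => 1⟩
  refine ⟨E.mkSol fun i => v i, fun k hk => E.mkSol_eq_init _ ⟨k, hk⟩, fun k => ?_⟩
  have := E.is_sol_mkSol (fun i => v i) k
  simpa [E, Finset.sum_range] using this

/-- With x fixed, `transfer_indicator` acts as a companion matrix. The seeds record which of the n
intervals between consecutive K_j contains x, in reversed order. -/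
theorem transfer_pow_indicator {n : ℕ} {β : ℝ} (hn : 2 ≤ n) (hβ_pos : 0 < β)
    (hβ : β ^ n = ∑ i ∈ Finset.range n, β ^ i) {x : ℝ} (hx : x ∈ Set.Ico (0 : ℝ) 1)
    {y : ℕ → ℝ} (hy : ∀ k < n, y k =
      (Set.Ico (partialSum β (n - 1 - k)) (partialSum β (n - 1 - k + 1))).indicator 1 x)
    (hrec : ∀ k, y (k + n) = ∑ i ∈ Finset.range n, y (k + i)) (m : ℕ) {j : ℕ} (hj : j ≤ n) :
    (transfer n β ^ m) ((Set.Ico 0 (partialSum β j)).indicator 1) x =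
      (β ^ m)⁻¹ * ∑ i ∈ Finset.range j, y (m + (n - 1 - i)) := by
  induction m generalizing j with
  | zero =>
    simp only [pow_zero, Module.End.one_apply, inv_one, one_mul, zero_add]
    rw [← sum_indicator_partialSum hβ_pos]
    refine Finset.sum_congr rfl fun i hi => ?_
    have hi := Finset.mem_range.1 hi
    rw [hy _ (by omega), show n - 1 - (n - 1 - i) = i by omega]
  | succ m ih =>
    cases j with
    | zero =>
      rw [partialSum_zero, Set.Ico_self, Set.indicator_empty']
      simp
    | succ j =>
      have h := transfer_pow_congr hn hβ_pos hβ m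
        (r := transfer n β ((Set.Ico 0 (partialSum β (j + 1))).indicator 1))
        (s := β⁻¹ • ((Set.Ico 0 (partialSum β n)).indicator 1 +
          (Set.Ico 0 (partialSum β j)).indicator 1))
        (fun z hz => by simpa using transfer_indicator hn hβ_pos hβ (by omega) hz) hx
      rw [pow_succ, Module.End.mul_apply, h, map_smul, map_add, Pi.smul_apply, Pi.add_apply,
        ih le_rfl, ih (by omega), smul_eq_mul, Finset.sum_range_succ' _ j, ← mul_add, ← mul_assoc,
        ← mul_inv, ← pow_succ', add_comm (Finset.sum _ _)]
      congr 2
      · refine Finset.sum_congr rfl fun i hi => ?_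
        have hi := Finset.mem_range.1 hi
        congr 1
        omega
      -- The indicator of [0, K_n) contributes n consecutive terms, which the recurrence collapses
      -- into the next one.
      · rw [Finset.sum_range_reflect (fun i => y (m + i)) n, ← hrec]
        congr 1
        omega

/-! ### The roots of the characteristic polynomial -/

theorem eval_charPoly (n : ℕ) (z : ℂ) :
    (charPoly n).eval z = z ^ n - ∑ i ∈ Finset.range n, z ^ i := by
  simp [charPoly, Polynomial.eval_finsetSum]

theorem charPoly_ne_zero {n : ℕ} (hn : 2 ≤ n) : charPoly n ≠ 0 := by
  intro h
  have := eval_charPoly n 0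
  rw [h, Polynomial.eval_zero, zero_pow (by omega), zero_sub,
    Finset.sum_eq_single_of_mem 0 (by simp; omega) (fun i _ hi => zero_pow hi)] at this
  simp at this

theorem sub_one_mul_charPoly (n : ℕ) :
    (Polynomial.X - 1) * charPoly n = Polynomial.X ^ (n + 1) - 2 * Polynomial.X ^ n + 1 := by
  rw [charPoly, mul_sub, mul_comm _ (Finset.sum _ _), geom_sum_mul]
  ring

theorem two_mul_pow_ne {n : ℕ} (hn : 2 ≤ n) : 2 * (2 * n) ^ n ≠ (n + 1) ^ (n + 1) := by
  intro h
  have h1 : n ∣ (n + 1) ^ (n + 1) := by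
    rw [← h]
    exact (dvd_pow (Dvd.intro_left 2 rfl) (by omega)).mul_left 2
  have h2 : Nat.Coprime n ((n + 1) ^ (n + 1)) := by simp
  have := h2.eq_one_of_dvd h1
  omega

/-- After multiplication by X - 1, a double root z satisfies z^n (2 - z) = 1 and (n + 1) z = 2n.
Eliminating z gives 2 (2n)^n = (n + 1)^(n + 1), which is impossible because n is coprime to n + 1.
-/
theorem nodup_roots_charPoly {n : ℕ} (hn : 2 ≤ n) : (charPoly n).roots.Nodup := by
  classical
  rw [Multiset.nodup_iff_count_le_one]
  intro z
  rw [Polynomial.count_roots]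
  by_contra! h
  obtain ⟨h0, h1⟩ := (Polynomial.one_lt_rootMultiplicity_iff_isRoot (charPoly_ne_zero hn)).1 h
  have e0 := congrArg (Polynomial.eval z) (sub_one_mul_charPoly n)
  have e1 := congrArg (fun p => Polynomial.eval z (Polynomial.derivative p))
    (sub_one_mul_charPoly n)
  obtain ⟨k, rfl⟩ : ∃ k, n = k + 1 := ⟨n - 1, by omega⟩
  simp only [Polynomial.derivative_mul, Polynomial.eval_add, Polynomial.eval_mul, h0.eq_zero,
    h1.eq_zero] at e0 e1
  simp at e0 e1
  have hz : z ≠ 0 := by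
    rintro rfl
    simp at e0
  have e2 : ((k : ℂ) + 1 + 1) * z = 2 * ((k : ℂ) + 1) := by
    refine mul_right_cancel₀ (pow_ne_zero k hz) ?_
    linear_combination -e1
  have e3 : (z ^ (k + 1)) * (2 - z) = 1 := by linear_combination e0
  have e4 : ((k : ℂ) + 1 + 1) * (2 - z) = 2 := by linear_combination -e2
  refine two_mul_pow_ne hn ?_
  have e5 : (2 : ℂ) * (2 * ((k : ℂ) + 1)) ^ (k + 1) = ((k : ℂ) + 1 + 1) ^ (k + 1 + 1) := by
    rw [← e2, mul_pow, pow_succ _ (k + 1)]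
    linear_combination ((k : ℂ) + 1 + 1) ^ (k + 1) * ((k : ℂ) + 1 + 1) * e3 -
      ((k : ℂ) + 1 + 1) ^ (k + 1) * z ^ (k + 1) * e4
  exact_mod_cast e5

theorem IsRootOrdering.injective {n : ℕ} (hn : 2 ≤ n) {lam : Fin n → ℂ}
    (h : IsRootOrdering n lam) : Function.Injective lam := by
  have := nodup_roots_charPoly hn
  rw [h.roots_eq] at this
  exact fun i j hij => Multiset.inj_on_of_nodup_map this i (by simp) j (by simp) hij

theorem IsRootOrdering.exists_eq_iff {n : ℕ} (hn : 2 ≤ n) {lam : Fin n → ℂ}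
    (h : IsRootOrdering n lam) (z : ℂ) :
    (∃ i, lam i = z) ↔ z ^ n = ∑ i ∈ Finset.range n, z ^ i := by
  have : z ∈ (charPoly n).roots ↔ z ^ n = ∑ i ∈ Finset.range n, z ^ i := by
    rw [Polynomial.mem_roots (charPoly_ne_zero hn), Polynomial.IsRoot, eval_charPoly, sub_eq_zero]
  rw [← this, h.roots_eq]
  simp

theorem norm_le_of_pow_eq_sum {n : ℕ} {β : ℝ} (hn : 2 ≤ n) (hβ_pos : 0 < β)
    (hβ : β ^ n = ∑ i ∈ Finset.range n, β ^ i) {z : ℂ}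
    (hz : z ^ n = ∑ i ∈ Finset.range n, z ^ i) : ‖z‖ ≤ β := by
  by_contra! h
  have hz0 : 0 < ‖z‖ := hβ_pos.trans h
  have h1 : ‖z‖ ^ n ≤ ∑ i ∈ Finset.range n, ‖z‖ ^ i := by
    rw [← norm_pow, hz]
    exact (norm_sum_le _ _).trans_eq (by simp)
  rw [← pow_mul_partialSum hz0] at h1
  have h2 : 1 ≤ partialSum ‖z‖ n :=
    le_of_mul_le_mul_left (by simpa using h1) (pow_pos hz0 n)
  have h3 : partialSum ‖z‖ n < partialSum β n := by
    refine Finset.sum_lt_sum_of_nonempty ⟨1, by simp; omega⟩ fun i hi => ?_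
    have hi := (Finset.mem_Icc.1 hi).1
    gcongr
  rw [partialSum_eq_one hβ_pos hβ] at h3
  linarith

/-- It suffices that β has maximal modulus; β need not be shown to come first. If another root did,
β would sit at index 1 or later, and |λ₂| ≥ β would bound every root. -/
theorem IsRootOrdering.norm_le_of_ne {n : ℕ} {β : ℝ} (hn : 2 ≤ n) (hβ_pos : 0 < β)
    (hβ : β ^ n = ∑ i ∈ Finset.range n, β ^ i) {lam : Fin n → ℂ} (h : IsRootOrdering n lam)
    {i j : Fin n} (hi : lam i = β) (hj : j ≠ i) : ‖lam j‖ ≤ ‖lam ⟨1, hn⟩‖ := by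
  have hjβ : ‖lam j‖ ≤ β :=
    norm_le_of_pow_eq_sum hn hβ_pos hβ ((h.exists_eq_iff hn _).1 ⟨j, rfl⟩)
  by_cases hj0 : (j : ℕ) = 0
  · have hle : (⟨1, hn⟩ : Fin n) ≤ i := by
      have : (i : ℕ) ≠ j := fun e => hj (Fin.ext e.symm)
      show 1 ≤ (i : ℕ)
      omega
    refine hjβ.trans (le_trans ?_ (h.antitone_norm hle))
    simp [hi, abs_of_pos hβ_pos]
  · exact h.antitone_norm (show (1 : ℕ) ≤ j by omega)

/-- For N = n this divides the characteristic polynomial by X - β. Hence the functional y ↦ ∑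
K_{i+1} y_i kills the geometric sequences of all roots other than β. -/
theorem sub_mul_sum_partialSum {β : ℝ} (hβ : 0 < β) (z : ℂ) (N : ℕ) :
    (z - β) * ∑ k ∈ Finset.range N, (partialSum β (k + 1) : ℂ) * z ^ k =
      partialSum β N * z ^ N - ∑ k ∈ Finset.range N, z ^ k := by
  induction N with
  | zero => simp [partialSum_zero]
  | succ N ih =>
    have h : (β : ℂ) * partialSum β (N + 1) = 1 + partialSum β N := by
      exact_mod_cast mul_partialSum_succ hβ N
    rw [Finset.sum_range_succ, mul_add, ih, Finset.sum_range_succ]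
    linear_combination (-z ^ N) * h

/-- The value at `β` of the quotient of the characteristic polynomial by `X - β`. -/
noncomputable def weight (n : ℕ) (β : ℝ) : ℝ :=
  ∑ k ∈ Finset.range n, partialSum β (k + 1) * β ^ k

theorem weight_pos {n : ℕ} (hn : 2 ≤ n) {β : ℝ} (hβ : 0 < β) : 0 < weight n β :=
  Finset.sum_pos (fun k _ => mul_pos
    ((inv_pos.2 hβ).trans_le (inv_le_partialSum hβ (by omega))) (pow_pos hβ k))
    ⟨0, by simp; omega⟩

theorem exists_abs_sub_le {n : ℕ} (hn : 2 ≤ n) {β : ℝ} (hβ_pos : 0 < β)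
    (hβ : β ^ n = ∑ i ∈ Finset.range n, β ^ i) {lam : Fin n → ℂ} (h : IsRootOrdering n lam) :
    ∃ C : ℝ, 0 ≤ C ∧ ∀ y : ℕ → ℝ, (∀ k < n, |y k| ≤ 1) →
      (∀ k, y (k + n) = ∑ i ∈ Finset.range n, y (k + i)) → ∀ k,
      |y k - (∑ i ∈ Finset.range n, partialSum β (i + 1) * y i) / weight n β * β ^ k| ≤
        C * ‖lam ⟨1, hn⟩‖ ^ k := by
  set V := (Matrix.vandermonde lam).transpose
  have hV : IsUnit V.det := by
    rw [Matrix.det_transpose, isUnit_iff_ne_zero, Matrix.det_vandermonde_ne_zero_iff]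
    exact h.injective hn
  obtain ⟨i₀, hi₀⟩ : ∃ i, lam i = β := (h.exists_eq_iff hn β).2 (by exact_mod_cast hβ)
  -- The mode coefficients are V⁻¹ applied to initial values of modulus at most 1, so this constant
  -- is uniform in y.
  refine ⟨∑ i, ∑ j, ‖V⁻¹ i j‖, by positivity, fun y hy hrec k => ?_⟩
  set a : Fin n → ℂ := V⁻¹.mulVec fun i => (y i : ℂ) with ha
  have hVa : V.mulVec a = fun i : Fin n => (y i : ℂ) := by
    rw [ha, Matrix.mulVec_mulVec, Matrix.mul_nonsing_inv _ hV, Matrix.one_mulVec]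
  have hsum : ∀ k, (y k : ℂ) = ∑ i, a i * lam i ^ k := by
    intro k
    induction k using Nat.strong_induction_on with
    | _ k ih =>
      by_cases hk : k < n
      · rw [← congrFun hVa ⟨k, hk⟩]
        simp [V, Matrix.mulVec, dotProduct, Matrix.vandermonde, mul_comm]
      · obtain ⟨k, rfl⟩ : ∃ l, k = l + n := ⟨k - n, by omega⟩
        rw [hrec, Complex.ofReal_sum, Finset.sum_congr rfl fun i hi =>
          ih (k + i) (by have := Finset.mem_range.1 hi; omega), Finset.sum_comm]
        refine Finset.sum_congr rfl fun i _ => ?_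
        rw [← Finset.mul_sum, pow_add, (h.exists_eq_iff hn _).1 ⟨i, rfl⟩, Finset.mul_sum, Finset.mul_sum]
        simp only [pow_add, ← Finset.mul_sum]
  have hai : ∀ i, ‖a i‖ ≤ ∑ j, ‖V⁻¹ i j‖ := fun i => by
    rw [ha, Matrix.mulVec, dotProduct]
    refine (norm_sum_le _ _).trans (Finset.sum_le_sum fun j _ => ?_)
    rw [norm_mul]
    refine mul_le_of_le_one_right (norm_nonneg _) ?_
    simpa using hy j j.2
  have hW := (weight_pos hn hβ_pos).ne'
  -- The functional isolates the coefficient of the β mode, on which it takes the value `weight n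
  -- β`.
  have hA : (((∑ i ∈ Finset.range n, partialSum β (i + 1) * y i) / weight n β : ℝ) : ℂ) =
      a i₀ := by
    rw [Complex.ofReal_div, div_eq_iff (by exact_mod_cast hW), Complex.ofReal_sum]
    simp only [Complex.ofReal_mul, hsum, Finset.mul_sum]
    rw [Finset.sum_comm, Finset.sum_eq_single i₀]
    · simp only [weight, hi₀, Complex.ofReal_sum, Complex.ofReal_mul, Complex.ofReal_pow,
        Finset.mul_sum]
      exact Finset.sum_congr rfl fun _ _ => by ring
    · intro i _ hi
      have h1 : lam i - β ≠ 0 := sub_ne_zero.2 fun e => hi (h.injective hn (e.trans hi₀.symm))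
      have h2 := sub_mul_sum_partialSum hβ_pos (lam i) n
      rw [partialSum_eq_one hβ_pos hβ, Complex.ofReal_one, one_mul,
        (h.exists_eq_iff hn _).1 ⟨i, rfl⟩, sub_self] at h2
      have h3 := (mul_eq_zero.1 h2).resolve_left h1
      rw [← mul_zero (a i), ← h3, Finset.mul_sum]
      exact Finset.sum_congr rfl fun _ _ => by ring
    · simp
  have key : ((y k - (∑ i ∈ Finset.range n, partialSum β (i + 1) * y i) / weight n β * β ^ k :
      ℝ) : ℂ) = ∑ i ∈ Finset.univ.erase i₀, a i * lam i ^ k := by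
    rw [Complex.ofReal_sub, Complex.ofReal_mul, hA, hsum, Complex.ofReal_pow,
      ← Finset.add_sum_erase _ _ (Finset.mem_univ i₀), hi₀]
    ring
  rw [← Real.norm_eq_abs, ← Complex.norm_real, key, Finset.sum_mul]
  refine (norm_sum_le _ _).trans (le_trans (Finset.sum_le_sum fun i hi => ?_)
    (Finset.sum_le_univ_sum_of_nonneg fun i => by positivity))
  rw [norm_mul, norm_pow]
  exact mul_le_mul (hai i) (pow_le_pow_left₀ (norm_nonneg _)
    (h.norm_le_of_ne hn hβ_pos hβ hi₀ (Finset.ne_of_mem_erase hi)) k) (by positivity)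
    (by positivity)

/-! ### The invariant density -/

section
variable {n : ℕ} {β : ℝ} (hn : 2 ≤ n) (hβ_pos : 0 < β)
  (hβ : β ^ n = ∑ i ∈ Finset.range n, β ^ i)
include hβ_pos hβ

theorem pow_sub_sum_eq {j : ℕ} (hj : j < n) :
    β ^ (j + 1) - ∑ i ∈ Finset.Icc 1 j, β ^ i = β * partialSum β (n - j) := by
  induction j with
  | zero => simp [partialSum_eq_one hβ_pos hβ]
  | succ j ih =>
    have h1 := ih (by omega)
    have h2 := mul_partialSum_succ hβ_pos (n - (j + 1))
    rw [show n - (j + 1) + 1 = n - j by omega] at h2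
    have h3 : ∑ i ∈ Finset.Icc 1 (j + 1), β ^ i = β * (1 + ∑ i ∈ Finset.Icc 1 j, β ^ i) := by
      clear h1 h2 ih hj
      induction j with
      | zero => simp
      | succ j ih =>
        have h4 := Finset.sum_Icc_succ_top (show 1 ≤ j + 1 by omega) fun i => β ^ i
        rw [Finset.sum_Icc_succ_top (by omega)]
        linear_combination ih - β * h4
    rw [h3, pow_succ]
    linear_combination β * h1 + β * h2

theorem sum_stepFun (x : ℝ) : ∑ j ∈ Finset.Icc 1 n, stepFun β j x =
    β * ∑ k ∈ Finset.range n, partialSum β (k + 1) *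
      (Set.Ico (partialSum β (n - 1 - k)) (partialSum β (n - 1 - k + 1))).indicator 1 x := by
  rw [← Finset.sum_range_reflect (fun k => partialSum β (k + 1) *
    (Set.Ico (partialSum β (n - 1 - k)) (partialSum β (n - 1 - k + 1))).indicator 1 x),
    Finset.mul_sum, ← Finset.Ico_add_one_right_eq_Icc, Finset.sum_Ico_eq_sum_range]
  refine Finset.sum_congr rfl fun i hi => ?_
  have hi := Finset.mem_range.1 hi
  rw [show n - 1 - (n - 1 - i) = i by omega, show n - 1 - i + 1 = n - i by omega,
    stepFun, add_comm 1 i, Nat.add_sub_cancel, pow_sub_sum_eq hβ_pos hβ (by omega)]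
  simp only [Set.indicator, Pi.one_apply]
  split_ifs <;> simp

theorem pow_mul_normConst : β ^ n * normConst n β = β * weight n β := by
  have hint : ∀ k : ℕ, MeasureTheory.IntegrableOn
      ((Set.Ico (partialSum β k) (partialSum β (k + 1))).indicator (1 : ℝ → ℝ))
      (Set.Ico (0 : ℝ) 1) := fun k =>
    (MeasureTheory.integrableOn_const (by simp)).indicator measurableSet_Ico
  have hval : ∀ k < n, ∫ x in Set.Ico (0 : ℝ) 1,
      (Set.Ico (partialSum β k) (partialSum β (k + 1))).indicator (1 : ℝ → ℝ) x =
        (β ^ (k + 1))⁻¹ := fun k hk => by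
    have hm := (partialSum_strictMono hβ_pos)
    have hsub : Set.Ico (partialSum β k) (partialSum β (k + 1)) ⊆ Set.Ico 0 1 :=
      Set.Ico_subset_Ico (partialSum_nonneg hβ_pos k)
        (partialSum_eq_one hβ_pos hβ ▸ hm.monotone hk)
    rw [MeasureTheory.setIntegral_indicator measurableSet_Ico, Set.inter_eq_right.2 hsub]
    have h2 := hm (Nat.lt_succ_self k)
    simp only [Pi.one_apply, MeasureTheory.setIntegral_const, smul_eq_mul, mul_one]
    rw [Real.volume_real_Ico_of_le h2.le, partialSum_succ]
    ring
  simp only [normConst, sum_stepFun hβ_pos hβ]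
  rw [MeasureTheory.integral_const_mul, MeasureTheory.integral_finsetSum _ fun k _ =>
    (hint _).const_mul _, mul_left_comm, Finset.mul_sum, weight]
  congr 1
  refine Finset.sum_congr rfl fun k hk => ?_
  have hk := Finset.mem_range.1 hk
  rw [MeasureTheory.integral_const_mul, hval _ (by omega)]
  have h : β ^ n = β ^ k * β ^ (n - 1 - k + 1) := by
    rw [← pow_add]
    congr 1
    omega
  rw [h]
  field_simp

include hn

/-- Up to the factor β^n, this is the β coefficient of the Fibonacci sequence seeded at x, which
identifies the limit of P^m. -/
theorem invDensity_eq (x : ℝ) : invDensity n β x =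
    (∑ k ∈ Finset.range n, partialSum β (k + 1) *
      (Set.Ico (partialSum β (n - 1 - k)) (partialSum β (n - 1 - k + 1))).indicator 1 x) /
      weight n β * β ^ n := by
  have h := pow_mul_normConst hβ_pos hβ
  have hW := weight_pos hn hβ_pos
  have hD : normConst n β = β * weight n β / β ^ n := by
    rw [← h]
    field_simp
  rw [invDensity, sum_stepFun hβ_pos hβ, hD]
  field_simp

theorem abs_invDensity_le (x : ℝ) : |invDensity n β x| ≤ n / weight n β * β ^ n := by
  have hW := weight_pos hn hβ_pos
  rw [invDensity_eq hn hβ_pos hβ, abs_mul, abs_div, abs_of_pos hW, abs_of_pos (pow_pos hβ_pos n)]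
  gcongr
  refine (Finset.abs_sum_le_sum_abs _ _).trans
    ((Finset.sum_le_card_nsmul _ _ 1 fun k hk => ?_).trans_eq (by simp))
  have hk := Finset.mem_range.1 hk
  rw [abs_mul, abs_of_nonneg (partialSum_nonneg hβ_pos _)]
  refine mul_le_one₀ ?_ (abs_nonneg _) ?_
  · rw [← partialSum_eq_one hβ_pos hβ]
    exact (partialSum_strictMono hβ_pos).monotone (by omega)
  · simp only [Set.indicator, Pi.one_apply]
    split_ifs <;> simp

theorem exists_abs_transfer_pow_indicator_sub_le {lam : Fin n → ℂ}
    (hlam : IsRootOrdering n lam) : ∃ C : ℝ, 0 ≤ C ∧ ∀ m : ℕ, ∀ j ≤ n,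
      ∀ x ∈ Set.Ico (0 : ℝ) 1,
        |(transfer n β ^ m) ((Set.Ico 0 (partialSum β j)).indicator 1) x -
          invDensity n β x * partialSum β j| ≤ C * (β⁻¹ * ‖lam ⟨1, hn⟩‖) ^ m := by
  obtain ⟨C, hC, h⟩ := exists_abs_sub_le hn hβ_pos hβ hlam
  set μ := ‖lam ⟨1, hn⟩‖ with hμ
  refine ⟨C * ∑ i ∈ Finset.range n, μ ^ (n - 1 - i), by positivity, fun m j hj x hx => ?_⟩
  obtain ⟨y, hy, hrec⟩ := exists_recurrence n fun k =>
    (Set.Ico (partialSum β (n - 1 - k)) (partialSum β (n - 1 - k + 1))).indicator 1 x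
  have hb := h y (fun k hk => by
    rw [hy k hk]
    simp only [Set.indicator, Pi.one_apply]
    split_ifs <;> simp) hrec
  have hf : (∑ i ∈ Finset.range n, partialSum β (i + 1) * y i) / weight n β =
      invDensity n β x / β ^ n := by
    rw [invDensity_eq hn hβ_pos hβ, mul_div_assoc, div_self (pow_pos hβ_pos n).ne', mul_one]
    congr 1
    exact Finset.sum_congr rfl fun k hk => by rw [hy k (Finset.mem_range.1 hk)]
  rw [hf] at hb
  -- The β modes sum to f_β(x) K_j because β^(n-1-i)/β^n = β^{-(1+i)}.
  have hK : invDensity n β x * partialSum β j = (β ^ m)⁻¹ *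
      ∑ i ∈ Finset.range j, invDensity n β x / β ^ n * β ^ (m + (n - 1 - i)) := by
    rw [partialSum, ← Finset.Ico_add_one_right_eq_Icc, Finset.sum_Ico_eq_sum_range,
      Finset.mul_sum, Finset.mul_sum]
    refine Finset.sum_congr rfl fun i hi => ?_
    have hi := Finset.mem_range.1 hi
    have : β ^ n = β ^ (1 + i) * β ^ (n - 1 - i) := by
      rw [← pow_add]
      congr 1
      omega
    rw [this, pow_add β m]
    field_simp
  rw [transfer_pow_indicator hn hβ_pos hβ hx hy hrec m hj, hK, ← mul_sub,
    ← Finset.sum_sub_distrib, abs_mul, abs_of_pos (inv_pos.2 (pow_pos hβ_pos m)), mul_pow,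
    inv_pow, mul_left_comm]
  refine mul_le_mul_of_nonneg_left ?_ (inv_pos.2 (pow_pos hβ_pos m)).le
  rw [mul_assoc, Finset.sum_mul, Finset.mul_sum]
  refine (Finset.abs_sum_le_sum_abs _ _).trans ((Finset.sum_le_sum fun i _ => hb _).trans ?_)
  refine (Finset.sum_le_sum_of_subset_of_nonneg (Finset.range_subset_range.2 hj)
    fun i _ _ => by positivity).trans_eq ?_
  exact Finset.sum_congr rfl fun i _ => by rw [pow_add, mul_comm (μ ^ m)]

theorem inv_mul_norm_le_one {lam : Fin n → ℂ} (hlam : IsRootOrdering n lam) (i : Fin n) :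
    β⁻¹ * ‖lam i‖ ≤ 1 := by
  rw [inv_mul_le_iff₀ hβ_pos, mul_one]
  exact norm_le_of_pow_eq_sum hn hβ_pos hβ ((hlam.exists_eq_iff hn _).1 ⟨i, rfl⟩)

theorem exists_transfer_pow_one_le {lam : Fin n → ℂ} (hlam : IsRootOrdering n lam) :
    ∃ B : ℝ, 0 ≤ B ∧ ∀ m : ℕ, ∀ x ∈ Set.Ico (0 : ℝ) 1, (transfer n β ^ m) 1 x ≤ B := by
  obtain ⟨C, hC, h⟩ := exists_abs_transfer_pow_indicator_sub_le hn hβ_pos hβ hlam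
  have hW := weight_pos hn hβ_pos
  refine ⟨n / weight n β * β ^ n + C, by positivity, fun m x hx => ?_⟩
  have h1 := (abs_le.1 (h m n le_rfl x hx)).2
  have h2 := (abs_le.1 (abs_invDensity_le hn hβ_pos hβ x)).2
  have h3 : C * (β⁻¹ * ‖lam ⟨1, hn⟩‖) ^ m ≤ C := mul_le_of_le_one_right hC
    (pow_le_one₀ (by positivity) (inv_mul_norm_le_one hn hβ_pos hβ hlam _))
  rw [partialSum_eq_one hβ_pos hβ, mul_one, transfer_pow_congr hn hβ_pos hβ m (s := 1)
    (fun z hz => Set.indicator_of_mem hz _) hx] at h1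
  linarith

/-! ### Approximation by step functions -/

/-- The step function obtained from `pushDensity` by freezing `g` at the left ends of the
cylinder intervals. -/
noncomputable def stepApprox (n : ℕ) (β : ℝ) (g : ℝ → ℝ) (m : ℕ) : ℝ → ℝ :=
  ∑ J ∈ Omega n m, ((β ^ m)⁻¹ * g (leftEnd β J)) •
    (Set.Ico 0 (scaledLength n β J)).indicator 1

omit hn hβ_pos hβ in
theorem IsLipschitzDensity.lipschitz_nonneg {g : ℝ → ℝ} {L : ℝ}
    (hg : IsLipschitzDensity g L) : 0 ≤ L := by
  have := (abs_nonneg _).trans (hg.lipschitz 0 (by norm_num) (1 / 2) (by norm_num))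
  norm_num at this
  exact this

/-- Each cylinder has length at most β^{-m}, so each active word costs at most L β^{-m}; P^m 1 is
β^{-m} times the number of words active at x. -/
theorem abs_pushDensity_sub_stepApprox_le {g : ℝ → ℝ} {L : ℝ} (hg : IsLipschitzDensity g L)
    (m : ℕ) {x : ℝ} (hx : x ∈ Set.Ico (0 : ℝ) 1) :
    |pushDensity n β g m x - stepApprox n β g m x| ≤
      L * (β ^ m)⁻¹ * (transfer n β ^ m) 1 x := by
  have hb : 0 < (β ^ m)⁻¹ := inv_pos.2 (pow_pos hβ_pos m)
  have hL := hg.lipschitz_nonneg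
  rw [← pushDensity_eq_transfer_pow hn hβ_pos hβ 1 m hx, pushDensity, stepApprox,
    Finset.sum_apply, Finset.mul_sum, ← Finset.sum_sub_distrib, pushDensity, mul_left_comm,
    Finset.mul_sum, Finset.mul_sum]
  refine (Finset.abs_sum_le_sum_abs _ _).trans (Finset.sum_le_sum fun J hJ => ?_)
  rw [mem_Omega] at hJ
  by_cases hxJ : x ∈ Set.Ico 0 (scaledLength n β J)
  · have h1 := leftEnd_add_mem hn hβ_pos hβ hJ hxJ
    have h0 := leftEnd_add_mem hn hβ_pos hβ hJ ⟨le_rfl, hxJ.1.trans_lt hxJ.2⟩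
    have := hg.lipschitz _ h1 _ h0
    rw [mul_zero, add_zero, add_sub_cancel_left, abs_of_nonneg (mul_nonneg hb.le hx.1)] at this
    simp only [Set.indicator_of_mem hxJ, Pi.smul_apply, Pi.one_apply, smul_eq_mul, mul_one]
    rw [← mul_sub, abs_mul, abs_of_pos hb]
    refine mul_le_mul_of_nonneg_left (this.trans (mul_le_mul_of_nonneg_left ?_ hL)) hb.le
    exact mul_le_of_le_one_right hb.le hx.2.le
  · simp [Set.indicator_of_notMem hxJ]

/-- The total mass of `stepApprox`. -/
noncomputable def stepMass (n : ℕ) (β : ℝ) (g : ℝ → ℝ) (m : ℕ) : ℝ :=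
  ∑ J ∈ Omega n m, ((β ^ m)⁻¹ * g (leftEnd β J)) * scaledLength n β J

omit hn in
theorem intervalIntegrable_and_integral_stepApprox (g : ℝ → ℝ) (m : ℕ) :
    IntervalIntegrable (stepApprox n β g m) MeasureTheory.volume 0 1 ∧
      ∫ x in (0 : ℝ)..1, stepApprox n β g m x = stepMass n β g m := by
  have hind : ∀ j, IntervalIntegrable ((Set.Ico 0 (partialSum β j)).indicator (1 : ℝ → ℝ))
      MeasureTheory.volume 0 1 := fun j => by
    rw [intervalIntegrable_iff_integrableOn_Ico_of_le zero_le_one]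
    exact (MeasureTheory.integrableOn_const (by simp)).indicator measurableSet_Ico
  have hval : ∀ j ≤ n, ∫ x in (0 : ℝ)..1,
      (Set.Ico 0 (partialSum β j)).indicator (1 : ℝ → ℝ) x = partialSum β j := fun j hj => by
    have hsub : Set.Ico 0 (partialSum β j) ⊆ Set.Ico 0 1 := Set.Ico_subset_Ico le_rfl
      (partialSum_eq_one hβ_pos hβ ▸ (partialSum_strictMono hβ_pos).monotone hj)
    rw [intervalIntegral.integral_of_le zero_le_one, MeasureTheory.integral_Ioc_eq_integral_Ioo,
      ← MeasureTheory.integral_Ico_eq_integral_Ioo,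
      MeasureTheory.setIntegral_indicator measurableSet_Ico, Set.inter_eq_right.2 hsub]
    simp [Real.volume_real_Ico_of_le (partialSum_nonneg hβ_pos j)]
  have hJ : ∀ J ∈ Omega n m, IntervalIntegrable (((β ^ m)⁻¹ * g (leftEnd β J)) •
      (Set.Ico 0 (scaledLength n β J)).indicator (1 : ℝ → ℝ)) MeasureTheory.volume 0 1 :=
    fun J _ => (hind _).smul _
  refine ⟨IntervalIntegrable.sum _ hJ, ?_⟩
  simp only [stepApprox, Finset.sum_apply]
  rw [intervalIntegral.integral_finsetSum hJ, stepMass]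
  refine Finset.sum_congr rfl fun J _ => ?_
  simp only [Pi.smul_apply]
  rw [intervalIntegral.integral_smul, scaledLength, hval _ (Nat.sub_le _ _), smul_eq_mul]

theorem abs_stepMass_sub_one_le {g : ℝ → ℝ} {L : ℝ} (hg : IsLipschitzDensity g L)
    {B : ℝ} (hB : ∀ m : ℕ, ∀ x ∈ Set.Ico (0 : ℝ) 1, (transfer n β ^ m) 1 x ≤ B) (m : ℕ) :
    |stepMass n β g m - 1| ≤ L * (β ^ m)⁻¹ * B := by
  have hL := hg.lipschitz_nonneg
  have hg0 : IntervalIntegrable g MeasureTheory.volume 0 1 := by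
    rw [intervalIntegrable_iff_integrableOn_Ico_of_le zero_le_one]
    -- The integral of a non-integrable function is 0 by convention, so the value 1 forces
    -- integrability.
    refine MeasureTheory.Integrable.of_integral_ne_zero ?_
    rw [hg.integral_eq_one]
    exact one_ne_zero
  have hg1 : ∫ x in (0 : ℝ)..1, g x = 1 := by
    rw [intervalIntegral.integral_of_le zero_le_one, MeasureTheory.integral_Ioc_eq_integral_Ioo,
      ← MeasureTheory.integral_Ico_eq_integral_Ioo, hg.integral_eq_one]
  obtain ⟨h1, h2⟩ := intervalIntegrable_and_integral_transfer_pow hn hβ_pos hβ hg0 m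
  obtain ⟨h3, h4⟩ := intervalIntegrable_and_integral_stepApprox hβ_pos hβ g m
  have h5 : stepMass n β g m - 1 =
      ∫ x in (0 : ℝ)..1, stepApprox n β g m x - (transfer n β ^ m) g x := by
    rw [intervalIntegral.integral_sub h3 h1, h4, h2, hg1]
  rw [h5, intervalIntegral.integral_congr_Ioo_of_le zero_le_one
      (g := fun x => stepApprox n β g m x - pushDensity n β g m x) fun x hx => by
        simp only [pushDensity_eq_transfer_pow hn hβ_pos hβ g m (Set.Ioo_subset_Ico_self hx)],
    intervalIntegral.integral_of_le zero_le_one, MeasureTheory.integral_Ioc_eq_integral_Ioo,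
    ← Real.norm_eq_abs]
  refine (MeasureTheory.norm_setIntegral_le_of_norm_le_const (C := L * (β ^ m)⁻¹ * B) (by simp)
    fun x hx => ?_).trans_eq (by simp)
  rw [Real.norm_eq_abs, abs_sub_comm]
  refine (abs_pushDensity_sub_stepApprox_le hn hβ_pos hβ hg m
    (Set.Ioo_subset_Ico_self hx)).trans ?_
  gcongr
  exact hB m x (Set.Ioo_subset_Ico_self hx)

/-- The coefficients are nonnegative and every scaled length is at least β⁻¹, so the coefficients
sum to at most β times the mass. No count of words is needed. -/
theorem abs_transfer_pow_stepApprox_sub_le {g : ℝ → ℝ} {L : ℝ} (hg : IsLipschitzDensity g L)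
    {C ρ : ℝ} {k : ℕ} {x : ℝ} (hC : 0 ≤ C * ρ ^ k) (h : ∀ j ≤ n,
      |(transfer n β ^ k) ((Set.Ico 0 (partialSum β j)).indicator 1) x -
        invDensity n β x * partialSum β j| ≤ C * ρ ^ k) (m : ℕ) :
    |(transfer n β ^ k) (stepApprox n β g m) x - invDensity n β x * stepMass n β g m| ≤
      C * ρ ^ k * (β * stepMass n β g m) := by
  rw [stepApprox, map_sum, Finset.sum_apply, stepMass, Finset.mul_sum, ← Finset.sum_sub_distrib,
    Finset.mul_sum, Finset.mul_sum]
  refine (Finset.abs_sum_le_sum_abs _ _).trans (Finset.sum_le_sum fun J hJ => ?_)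
  rw [mem_Omega] at hJ
  have hr := trailingOnes_lt_of_mem hJ
  have hK : β⁻¹ ≤ scaledLength n β J := inv_le_partialSum hβ_pos (by omega)
  have h0 := leftEnd_add_mem hn hβ_pos hβ hJ ⟨le_rfl, (inv_pos.2 hβ_pos).trans_le hK⟩
  rw [mul_zero, add_zero] at h0
  have hc : 0 ≤ (β ^ m)⁻¹ * g (leftEnd β J) :=
    mul_nonneg (inv_pos.2 (pow_pos hβ_pos m)).le (hg.nonneg _ h0)
  set c := (β ^ m)⁻¹ * g (leftEnd β J)
  have h1 := h (n - trailingOnes J) (Nat.sub_le _ _)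
  rw [← scaledLength] at h1
  rw [map_smul, Pi.smul_apply, smul_eq_mul, mul_left_comm, ← mul_sub, abs_mul, abs_of_nonneg hc]
  have h2 : 1 ≤ β * scaledLength n β J := by
    rwa [inv_le_iff_one_le_mul₀' hβ_pos] at hK
  calc c * _ ≤ c * (C * ρ ^ k) := mul_le_mul_of_nonneg_left h1 hc
    _ ≤ (c * (C * ρ ^ k)) * (β * scaledLength n β J) :=
      le_mul_of_one_le_right (mul_nonneg hc hC) h2
    _ = _ := by ring
end

end PseudoGolden

/-! ### The error estimate. -/

theorem mainTheorem3 (n : ℕ) (hn : 2 ≤ n) (β : ℝ) (hβ_pos : 0 < β)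
    (hβ : β ^ n = ∑ i ∈ Finset.range n, β ^ i)
    (lam : Fin n → ℂ) (hlam : PseudoGolden.IsRootOrdering n lam) :
    ∃ C₁ C₂ : ℝ, 0 ≤ C₁ ∧ 0 ≤ C₂ ∧
      ∀ (g : ℝ → ℝ) (L : ℝ), PseudoGolden.IsLipschitzDensity g L →
        ∀ m m₁ m₂ : ℕ, 2 * n < m → n - 1 ≤ m₁ → 2 * n - 1 < m₂ → m₁ + m₂ = m →
          PseudoGolden.supDist (PseudoGolden.pushDensity n β g m)
              (PseudoGolden.invDensity n β) ≤
            ENNReal.ofReal (C₁ * (β ^ m₁)⁻¹ * L + C₂ * (β⁻¹ * ‖lam ⟨1, hn⟩‖) ^ m₂) := by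
  open PseudoGolden in
  obtain ⟨B, hB0, hB⟩ := exists_transfer_pow_one_le hn hβ_pos hβ hlam
  obtain ⟨C, hC0, hC⟩ := exists_abs_transfer_pow_indicator_sub_le hn hβ_pos hβ hlam
  have hρ0 : 0 ≤ β⁻¹ * ‖lam ⟨1, hn⟩‖ := by positivity
  have hρ1 := inv_mul_norm_le_one hn hβ_pos hβ hlam ⟨1, hn⟩
  set ρ := β⁻¹ * ‖lam ⟨1, hn⟩‖
  have hW := weight_pos hn hβ_pos
  set M := n / weight n β * β ^ n with hM
  have hM0 : 0 ≤ M := by positivity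
  -- B bounds every P^k 1 and M bounds |f_β|. The terms of the first constant come from the freezing
  -- error pushed through P^{m₂}, the mass defect times f_β, and the possible excess of mass over 1
  -- in the spectral error.
  refine ⟨B * B + M * B + C * β * B, C * β, by positivity, by positivity, ?_⟩
  intro g L hg m m₁ m₂ _ _ _ hm
  refine iSup₂_le fun x hx => ENNReal.ofReal_le_ofReal ?_
  have hL := hg.lipschitz_nonneg
  have hS := abs_stepMass_sub_one_le hn hβ_pos hβ hg hB m₁
  have hv := abs_transfer_pow_stepApprox_sub_le hn hβ_pos hβ hg (by positivity)
    (fun j hj => hC m₂ j hj x hx) m₁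
  have hf := abs_invDensity_le hn hβ_pos hβ x
  rw [← hM] at hf
  set S := stepMass n β g m₁
  set f := invDensity n β x
  set E := L * (β ^ m₁)⁻¹ * B with hE
  have hE0 : 0 ≤ E := by positivity
  have hr : |pushDensity n β g m x - (transfer n β ^ m₂) (stepApprox n β g m₁) x| ≤ E * B := by
    have h1 : pushDensity n β g m x = (transfer n β ^ m₂) (pushDensity n β g m₁) x := by
      rw [pushDensity_eq_transfer_pow hn hβ_pos hβ g m hx, ← hm, add_comm, pow_add,
        Module.End.mul_apply]
      exact transfer_pow_congr hn hβ_pos hβ m₂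
        (fun y hy => (pushDensity_eq_transfer_pow hn hβ_pos hβ g m₁ hy).symm) hx
    have h2 := abs_transfer_pow_le hn hβ_pos hβ m₂
      (r := pushDensity n β g m₁ - stepApprox n β g m₁) (s := E • 1) (fun y hy => by
        refine (abs_pushDensity_sub_stepApprox_le hn hβ_pos hβ hg m₁ hy).trans ?_
        simp only [Pi.smul_apply, Pi.one_apply, smul_eq_mul, mul_one, hE]
        gcongr
        exact hB m₁ y hy) hx
    rw [map_sub, map_smul, Pi.sub_apply, Pi.smul_apply, smul_eq_mul, ← h1] at h2
    exact h2.trans (mul_le_mul_of_nonneg_left (hB m₂ x hx) hE0)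
  have hfS : |f * S - f| ≤ M * E := by
    rw [← mul_sub_one, abs_mul]
    exact mul_le_mul hf hS (abs_nonneg _) hM0
  have hS1 : S ≤ 1 + E := by linarith [(abs_le.1 hS).2]
  have hρm : ρ ^ m₂ ≤ 1 := pow_le_one₀ hρ0 hρ1
  have hlast : C * ρ ^ m₂ * (β * S) ≤ C * β * ρ ^ m₂ + C * β * E := by
    calc C * ρ ^ m₂ * (β * S) ≤ C * ρ ^ m₂ * (β * (1 + E)) := by gcongr
      _ = C * β * ρ ^ m₂ + C * β * E * ρ ^ m₂ := by ring
      _ ≤ _ := add_le_add le_rfl (mul_le_of_le_one_right (by positivity) hρm)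
  calc |pushDensity n β g m x - f|
      ≤ |pushDensity n β g m x - (transfer n β ^ m₂) (stepApprox n β g m₁) x| +
        (|(transfer n β ^ m₂) (stepApprox n β g m₁) x - f * S| + |f * S - f|) :=
        (abs_sub_le _ _ _).trans (by gcongr; exact abs_sub_le _ _ _)
    _ ≤ E * B + (C * β * ρ ^ m₂ + C * β * E + M * E) := by gcongr; exact hv.trans hlast
    _ = _ := by
      rw [hE]
      ring
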